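/- For real numbers $\alpha,\beta$ let $$A_1=\begin{pmatrix}\cos\alpha&0\\0&\cos\beta\end{pmatrix},\qquad A_2=\begin{pmatrix}0&\sin\beta\\ \sin\alpha&0\end{pmatrix},$$ and let $\Phi(\rho)=A_1\rho A_1^*+A_2\rho A_2^*$ be the qubit channel on $2\times 2$ complex matrices with Kraus operators $A_1,A_2$. Assume that its Choi matrix $\sum_{i,j}E_{ij}\otimes\Phi(E_{ij})$ has rank $2$. Then $\Phi$ is antidegradable if and only if $\cos(2\alpha)\cos(2\beta)\le 0$. Here a channel is a completely positive trace-preserving linear map between full matrix algebras. Two channels $\Psi$ (with output space $\mathcal Y$) and $\widetilde\Psi$ (with output space $\mathcal Z$) on the same input space $\mathcal X$ are complementary if there is an isometry $V:\mathcal X\to\mathcal Y\otimes\mathcal Z$ such that $\Psi(\rho)=\operatorname{tr}_{\mathcal Z}(V\rho V^*)$ and $\widetilde\Psi(\rho)=\operatorname{tr}_{\mathcal Y}(V\rho V^*)$ for all $\rho$. A channel $\Psi$ is antidegradable if there are a complementary channel $\widetilde\Psi$ of $\Psi$ (with $\mathcal Z$ finite-dimensional) and a channel $\Xi$ such that $\Psi=\Xi\circ\widetilde\Psi$.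 -/

import Mathlib

open scoped Matrix ComplexOrder

namespace QChannel

variable {m n k ι : Type*}

/-- The map `id ⊗ Φ`: apply `Φ` to every block of a block matrix. -/
def ampliation (r : ℕ) (Φ : Matrix n n ℂ →ₗ[ℂ] Matrix m m ℂ)
    (M : Matrix (Fin r × n) (Fin r × n) ℂ) : Matrix (Fin r × m) (Fin r × m) ℂ :=
  Matrix.of fun p q => Φ (Matrix.of fun a b => M (p.1, a) (q.1, b)) p.2 q.2

/-- Complete positivity: `id_r ⊗ Φ` preserves positive semidefiniteness for every `r`. -/
def IsCompletelyPositive (Φ : Matrix n n ℂ →ₗ[ℂ] Matrix m m ℂ) : Prop :=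
  ∀ (r : ℕ) (M : Matrix (Fin r × n) (Fin r × n) ℂ),
    M.PosSemidef → (ampliation r Φ M).PosSemidef

/-- Quantum channels: completely positive trace preserving linear maps. -/
structure IsChannel [Fintype m] [Fintype n] (Φ : Matrix n n ℂ →ₗ[ℂ] Matrix m m ℂ) : Prop where
  completelyPositive : IsCompletelyPositive Φ
  tracePreserving : ∀ ρ : Matrix n n ℂ, (Φ ρ).trace = ρ.trace

/-- The partial trace over the second tensor factor. -/
def traceSnd [Fintype k] (M : Matrix (m × k) (m × k) ℂ) : Matrix m m ℂ :=
  Matrix.of fun a b => ∑ e, M (a, e) (b, e)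

/-- The partial trace over the first tensor factor. -/
def traceFst [Fintype m] (M : Matrix (m × k) (m × k) ℂ) : Matrix k k ℂ :=
  Matrix.of fun e f => ∑ a, M (a, e) (a, f)

/-- Two channels are complementary if a common Stinespring isometry `V` from the input space
to (output space) ⊗ (environment) yields them by tracing out the environment and the output
space, respectively. -/
def IsComplementary [Fintype m] [Fintype n] [DecidableEq n] [Fintype k]
    (Ψ : Matrix n n ℂ →ₗ[ℂ] Matrix m m ℂ) (Ψc : Matrix n n ℂ →ₗ[ℂ] Matrix k k ℂ) : Prop :=
  IsChannel Ψ ∧ IsChannel Ψc ∧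
    ∃ V : Matrix (m × k) n ℂ, Vᴴ * V = 1 ∧
      (∀ ρ, Ψ ρ = traceSnd (V * ρ * Vᴴ)) ∧ (∀ ρ, Ψc ρ = traceFst (V * ρ * Vᴴ))

/-- A channel `Ψ` is antidegradable if `Ψ = Ξ ∘ Ψc` for a complementary channel `Ψc`
(into the operators on some finite-dimensional environment) and some channel `Ξ`. -/
def IsAntidegradable [Fintype m] [Fintype n] [DecidableEq n]
    (Ψ : Matrix n n ℂ →ₗ[ℂ] Matrix m m ℂ) : Prop :=
  ∃ (d : ℕ) (Ψc : Matrix n n ℂ →ₗ[ℂ] Matrix (Fin d) (Fin d) ℂ)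
    (Ξ : Matrix (Fin d) (Fin d) ℂ →ₗ[ℂ] Matrix m m ℂ),
    IsComplementary Ψ Ψc ∧ IsChannel Ξ ∧ Ψ = Ξ ∘ₗ Ψc

/-- The Choi matrix `∑ i j, E i j ⊗ Φ (E i j)`. -/
def choiMatrix [DecidableEq n] (Φ : Matrix n n ℂ →ₗ[ℂ] Matrix m m ℂ) :
    Matrix (n × m) (n × m) ℂ :=
  Matrix.of fun p q => Φ (Matrix.single p.1 q.1 1) p.2 q.2

/-- The map `ρ ↦ ∑ i, K i * ρ * (K i)ᴴ` with Kraus operators `K i`. -/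
def krausMap [Fintype ι] [Fintype n] (K : ι → Matrix m n ℂ) :
    Matrix n n ℂ →ₗ[ℂ] Matrix m m ℂ where
  toFun ρ := ∑ i, K i * ρ * (K i)ᴴ
  map_add' ρ σ := by simp only [Matrix.mul_add, Matrix.add_mul, Finset.sum_add_distrib]
  map_smul' c ρ := by
    simp only [Matrix.mul_smul, Matrix.smul_mul, Finset.smul_sum, RingHom.id_apply]

/-- The Kraus operator `diag (cos α, cos β)`. -/
noncomputable def kraus₁ (α β : ℝ) : Matrix (Fin 2) (Fin 2) ℂ :=
  !![(Real.cos α : ℂ), 0; 0, (Real.cos β : ℂ)]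

/-- The off-diagonal Kraus operator with entries `sin β` (top right) and `sin α` (bottom left). -/
noncomputable def kraus₂ (α β : ℝ) : Matrix (Fin 2) (Fin 2) ℂ :=
  !![0, (Real.sin β : ℂ); (Real.sin α : ℂ), 0]

end QChannel

namespace QChannel

open Matrix

/-! ### Kraus maps, Choi rank and environment vectors. -/

section General

variable {m n k ι : Type*}

/-! Write `a, b` for the cosines and `s, t` for the sines of `α, β`. A complement of the channel has
the same shape with `b` and `t` exchanged. If the product is nonpositive, a degrading map of this
shape exists, its two weights solving a linear system with a nonnegative solution
(`exists_weights`). Conversely, any complement sends `E₀₀` and `E₁₁` to combinations of the same two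
pure states `ff*`, `gg*` (`exists_unit_of_gram`), with weights `a², s²` and `b², t²`. The degrading
map turns these states into matrices with top left entries `p, q` in `[0, 1]`; comparing top left
entries gives two linear equations that force the sign (`mul_nonpos_of_probabilities`). -/

theorem IsCompletelyPositive.posSemidef_apply {Φ : Matrix n n ℂ →ₗ[ℂ] Matrix m m ℂ}
    (h : IsCompletelyPositive Φ) {M : Matrix n n ℂ} (hM : M.PosSemidef) :
    (Φ M).PosSemidef :=
  (h 1 _ (hM.submatrix (Prod.snd : Fin 1 × n → n))).submatrix fun a => ((0 : Fin 1), a)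

theorem isCompletelyPositive_krausMap [Finite m] [Fintype n] [Fintype ι]
    (K : ι → Matrix m n ℂ) : IsCompletelyPositive (krausMap K) := by
  intro r M hM
  have := Fintype.ofFinite m
  -- `L i` is `1 ⊗ K i`.
  let L : ι → Matrix (Fin r × m) (Fin r × n) ℂ := fun i =>
    Matrix.of fun p q => if p.1 = q.1 then K i p.2 q.2 else 0
  have hL : ampliation r (krausMap K) M = ∑ i, L i * M * (L i)ᴴ := by
    ext ⟨p, a⟩ ⟨q, b⟩
    simp [ampliation, krausMap, L, Matrix.sum_apply, Matrix.mul_apply, Fintype.sum_prod_type,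
      ite_mul, apply_ite, Finset.sum_ite_irrel]
  rw [hL]
  exact posSemidef_sum _ fun i _ => hM.mul_mul_conjTranspose_same (L i)

theorem isChannel_krausMap [Fintype m] [Fintype n] [DecidableEq n] [Fintype ι]
    {K : ι → Matrix m n ℂ} (hK : ∑ i, (K i)ᴴ * K i = 1) : IsChannel (krausMap K) where
  completelyPositive := isCompletelyPositive_krausMap K
  tracePreserving ρ := by
    have h : (krausMap K ρ).trace = ((∑ i, (K i)ᴴ * K i) * ρ).trace := by
      simp only [krausMap, LinearMap.coe_mk, AddHom.coe_mk, trace_sum, Finset.sum_mul]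
      exact Finset.sum_congr rfl fun i _ => trace_mul_cycle _ _ _
    rw [h, hK, one_mul]

theorem traceSnd_eq_krausMap [Fintype n] [Fintype k] (V : Matrix (m × k) n ℂ)
    (ρ : Matrix n n ℂ) :
    traceSnd (V * ρ * Vᴴ) = krausMap (fun e => Matrix.of fun a j => V (a, e) j) ρ := by
  ext a b
  simp [traceSnd, krausMap, Matrix.sum_apply, Matrix.mul_apply]

theorem traceFst_eq_krausMap [Fintype n] [Fintype m] (V : Matrix (m × k) n ℂ)
    (ρ : Matrix n n ℂ) :
    traceFst (V * ρ * Vᴴ) = krausMap (fun a => Matrix.of fun e j => V (a, e) j) ρ := by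
  ext e f
  simp [traceFst, krausMap, Matrix.sum_apply, Matrix.mul_apply]

theorem krausMap_single_apply [Fintype n] [DecidableEq n] [Fintype ι] (K : ι → Matrix m n ℂ)
    (i j : n) (a b : m) :
    krausMap K (Matrix.single i j 1) a b = ∑ l, K l a i * star (K l b j) := by
  simp [krausMap, Matrix.sum_apply, Matrix.mul_apply, Matrix.single_apply, ite_and]

theorem choiMatrix_krausMap [Fintype n] [DecidableEq n] [Fintype ι] (K : ι → Matrix m n ℂ) :
    choiMatrix (krausMap K) =
      ∑ l, vecMulVec (fun p : n × m => K l p.2 p.1) (fun p => star (K l p.2 p.1)) := by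
  ext p q
  simp [choiMatrix, krausMap_single_apply, Matrix.sum_apply, vecMulVec_apply]

theorem rank_choiMatrix_krausMap_pair_le [Fintype m] [Fintype n] [DecidableEq n]
    {A B : Matrix m n ℂ} (h : A = 0 ∨ B = 0) : (choiMatrix (krausMap ![A, B])).rank ≤ 1 := by
  rw [choiMatrix_krausMap]
  rcases h with rfl | rfl
  · simpa [Fin.sum_univ_two, ← Pi.zero_def] using rank_vecMulVec_le _ _
  · simpa [Fin.sum_univ_two, ← Pi.zero_def] using rank_vecMulVec_le _ _

/-- Two vectors with the Gram matrix of `a • f`, `b • f`, for a unit vector `f`,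
are of this form. -/
theorem exists_unit_of_gram [Fintype k] {a b : ℝ} (hab : a ≠ 0 ∨ b ≠ 0) {x y : k → ℂ}
    (hxx : ∑ e, x e * star (x e) = (a : ℂ) ^ 2) (hyy : ∑ e, y e * star (y e) = (b : ℂ) ^ 2)
    (hxy : ∑ e, x e * star (y e) = (a : ℂ) * b) :
    ∃ f : k → ℂ, ∑ e, f e * star (f e) = 1 ∧ x = (a : ℂ) • f ∧ y = (b : ℂ) • f := by
  have hN : (a : ℂ) ^ 2 + (b : ℂ) ^ 2 ≠ 0 := by
    have : a ^ 2 + b ^ 2 ≠ 0 := by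
      rcases hab with h | h <;> positivity
    exact_mod_cast this
  have hyx : ∑ e, y e * star (x e) = (a : ℂ) * b := by
    have := congrArg star hxy
    simpa [star_sum, mul_comm] using this
  have hz : ∑ e, ((b : ℂ) * x e - a * y e) * star ((b : ℂ) * x e - a * y e) = 0 := by
    calc _ = (b : ℂ) ^ 2 * ∑ e, x e * star (x e) - a * b * ∑ e, x e * star (y e)
          - a * b * ∑ e, y e * star (x e) + (a : ℂ) ^ 2 * ∑ e, y e * star (y e) := by
          simp only [Finset.mul_sum, ← Finset.sum_sub_distrib, ← Finset.sum_add_distrib]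
          refine Finset.sum_congr rfl fun e _ => ?_
          simp
          ring
      _ = 0 := by rw [hxx, hyy, hxy, hyx]; ring
  have hlin : ∀ e, (b : ℂ) * x e = a * y e := by
    intro e
    have h := (Finset.sum_eq_zero_iff_of_nonneg
      (fun e _ => mul_star_self_nonneg ((b : ℂ) * x e - a * y e))).1 hz e (Finset.mem_univ e)
    rw [mul_eq_zero, star_eq_zero, or_self] at h
    exact sub_eq_zero.1 h
  -- This least-squares choice avoids dividing by `a` or `b`, either of which may vanish.
  refine ⟨fun e => ((a : ℂ) * x e + b * y e) / ((a : ℂ) ^ 2 + (b : ℂ) ^ 2), ?_, ?_, ?_⟩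
  · calc _ = ((a : ℂ) ^ 2 * ∑ e, x e * star (x e) + a * b * ∑ e, x e * star (y e)
          + a * b * ∑ e, y e * star (x e) + (b : ℂ) ^ 2 * ∑ e, y e * star (y e))
            / ((a : ℂ) ^ 2 + (b : ℂ) ^ 2) ^ 2 := by
          simp only [Finset.mul_sum, ← Finset.sum_add_distrib, Finset.sum_div]
          refine Finset.sum_congr rfl fun e _ => ?_
          simp
          field_simp
          ring
      _ = 1 := by
          rw [hxx, hyy, hxy, hyx]
          field_simp
          ring
  · ext e
    simp only [Pi.smul_apply, smul_eq_mul]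
    field_simp
    linear_combination (b : ℂ) * hlin e
  · ext e
    simp only [Pi.smul_apply, smul_eq_mul]
    field_simp
    linear_combination -(a : ℂ) * hlin e

/-- A channel into the qubit operators maps a pure state to a matrix whose top left entry is a
probability. -/
theorem IsChannel.exists_prob [Fintype k] {Ξ : Matrix k k ℂ →ₗ[ℂ] Matrix (Fin 2) (Fin 2) ℂ}
    (hΞ : IsChannel Ξ) {f : k → ℂ} (hf : ∑ e, f e * star (f e) = 1) :
    ∃ p : ℝ, 0 ≤ p ∧ p ≤ 1 ∧ Ξ (vecMulVec f (star f)) 0 0 = p := by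
  have hpos := hΞ.completelyPositive.posSemidef_apply (posSemidef_vecMulVec_self_star f)
  have htr : (Ξ (vecMulVec f (star f))).trace = 1 := by
    rw [hΞ.tracePreserving, ← hf]
    simp [Matrix.trace, vecMulVec_apply]
  rw [trace_fin_two] at htr
  have h0 := Complex.nonneg_iff.1 (hpos.diag_nonneg (i := (0 : Fin 2)))
  have h1 := Complex.nonneg_iff.1 (hpos.diag_nonneg (i := (1 : Fin 2)))
  refine ⟨(Ξ (vecMulVec f (star f)) 0 0).re, h0.1, ?_, ?_⟩
  · have := congrArg Complex.re htr
    simp only [Complex.add_re, Complex.one_re] at this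
    linarith [h1.1]
  · exact Complex.ext rfl (by simp [← h0.2])

end General

/-! ### The two-parameter family and its degrading maps. -/

/-- The pair of Kraus operators `diag (c, d)` and the antidiagonal matrix with entries `f` (top
right) and `e` (bottom left). -/
def krausPair (c d e f : ℝ) : Fin 2 → Matrix (Fin 2) (Fin 2) ℂ :=
  ![!![(c : ℂ), 0; 0, (d : ℂ)], !![0, (f : ℂ); (e : ℂ), 0]]

theorem krausPair_cos_sin (α β : ℝ) :
    krausPair (Real.cos α) (Real.cos β) (Real.sin α) (Real.sin β) = ![kraus₁ α β, kraus₂ α β] :=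
  rfl

theorem krausMap_krausPair (c d e f : ℝ) (ρ : Matrix (Fin 2) (Fin 2) ℂ) :
    krausMap (krausPair c d e f) ρ =
      !![(c : ℂ) ^ 2 * ρ 0 0 + (f : ℂ) ^ 2 * ρ 1 1, (c : ℂ) * d * ρ 0 1 + (e : ℂ) * f * ρ 1 0;
        (c : ℂ) * d * ρ 1 0 + (e : ℂ) * f * ρ 0 1, (d : ℂ) ^ 2 * ρ 1 1 + (e : ℂ) ^ 2 * ρ 0 0] := by
  ext i j
  simp only [krausMap, LinearMap.coe_mk, AddHom.coe_mk, Matrix.add_apply, Matrix.mul_apply,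
    Fin.sum_univ_two, conjTranspose_apply]
  fin_cases i <;> fin_cases j <;> simp [krausPair, Complex.conj_ofReal] <;> ring

theorem isChannel_krausMap_krausPair {c d e f : ℝ} (h₀ : c ^ 2 + e ^ 2 = 1)
    (h₁ : d ^ 2 + f ^ 2 = 1) : IsChannel (krausMap (krausPair c d e f)) := by
  have hc₀ : (c : ℂ) ^ 2 + (e : ℂ) ^ 2 = 1 := by exact_mod_cast h₀
  have hc₁ : (d : ℂ) ^ 2 + (f : ℂ) ^ 2 = 1 := by exact_mod_cast h₁
  apply isChannel_krausMap
  ext i j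
  fin_cases i <;> fin_cases j <;>
    simp [krausPair, Fin.sum_univ_two, Matrix.mul_apply, Complex.conj_ofReal]
  · linear_combination hc₀
  · linear_combination hc₁

theorem isComplementary_krausMap_krausPair {a b s t : ℝ} (h₀ : a ^ 2 + s ^ 2 = 1)
    (h₁ : b ^ 2 + t ^ 2 = 1) :
    IsComplementary (krausMap (krausPair a b s t)) (krausMap (krausPair a t s b)) := by
  have hc₀ : (a : ℂ) ^ 2 + (s : ℂ) ^ 2 = 1 := by exact_mod_cast h₀
  have hc₁ : (b : ℂ) ^ 2 + (t : ℂ) ^ 2 = 1 := by exact_mod_cast h₁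
  refine ⟨isChannel_krausMap_krausPair h₀ h₁,
    isChannel_krausMap_krausPair h₀ (by rw [add_comm, h₁]),
    Matrix.of fun p j => krausPair a b s t p.2 p.1 j, ?_, fun ρ => ?_, fun ρ => ?_⟩
  · ext i j
    fin_cases i <;> fin_cases j <;>
      simp [krausPair, Fintype.sum_prod_type, Fin.sum_univ_two, Matrix.mul_apply,
        Complex.conj_ofReal]
    · linear_combination hc₀
    · linear_combination hc₁
  · rw [traceSnd_eq_krausMap]
    rfl
  · rw [traceFst_eq_krausMap]
    congr 2
    ext x e j
    fin_cases x <;> fin_cases e <;> fin_cases j <;> simp [krausPair]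

/-- The degrading map sends the complementary channel back to the channel. -/
theorem krausMap_krausPair_comp {a b s t x y : ℝ} (hx : 0 ≤ x) (hy : 0 ≤ y)
    (h₀ : t ^ 2 * x + s ^ 2 * y = 1) (h₁ : b ^ 2 * x + a ^ 2 * y = 1) :
    krausMap (krausPair a b s t) =
      krausMap (krausPair (√x * t) (√x * b) (√y * s) (√y * a)) ∘ₗ
        krausMap (krausPair a t s b) := by
  have hcx : ((√x : ℝ) : ℂ) ^ 2 = x := by exact_mod_cast Real.sq_sqrt hx
  have hcy : ((√y : ℝ) : ℂ) ^ 2 = y := by exact_mod_cast Real.sq_sqrt hy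
  have hc₀ : (t : ℂ) ^ 2 * x + (s : ℂ) ^ 2 * y = 1 := by exact_mod_cast h₀
  have hc₁ : (b : ℂ) ^ 2 * x + (a : ℂ) ^ 2 * y = 1 := by exact_mod_cast h₁
  rw [← hcx, ← hcy] at hc₀ hc₁
  refine LinearMap.ext fun ρ => ?_
  rw [LinearMap.comp_apply, krausMap_krausPair, krausMap_krausPair, krausMap_krausPair]
  ext i j
  fin_cases i <;> fin_cases j <;> simp
  · linear_combination -(a : ℂ) ^ 2 * ρ 0 0 * hc₀ - (t : ℂ) ^ 2 * ρ 1 1 * hc₁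
  · linear_combination -(a : ℂ) * b * ρ 0 1 * hc₀ - (s : ℂ) * t * ρ 1 0 * hc₁
  · linear_combination -(a : ℂ) * b * ρ 1 0 * hc₀ - (s : ℂ) * t * ρ 0 1 * hc₁
  · linear_combination -(s : ℂ) ^ 2 * ρ 0 0 * hc₁ - (b : ℂ) ^ 2 * ρ 1 1 * hc₀

/-- The weights of the degrading map. -/
theorem exists_weights {a b s t : ℝ} (h₀ : a ^ 2 + s ^ 2 = 1) (h₁ : b ^ 2 + t ^ 2 = 1)
    (h : (a ^ 2 - s ^ 2) * (b ^ 2 - t ^ 2) ≤ 0) :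
    ∃ x y : ℝ, 0 ≤ x ∧ 0 ≤ y ∧ t ^ 2 * x + s ^ 2 * y = 1 ∧ b ^ 2 * x + a ^ 2 * y = 1 := by
  obtain ⟨u, hu⟩ : ∃ u, u = a ^ 2 - s ^ 2 := ⟨_, rfl⟩
  obtain ⟨w, hw⟩ : ∃ w, w = b ^ 2 - t ^ 2 := ⟨_, rfl⟩
  have ha : a ^ 2 = (1 + u) / 2 := by linarith
  have hs : s ^ 2 = (1 - u) / 2 := by linarith
  have hb : b ^ 2 = (1 + w) / 2 := by linarith
  have ht : t ^ 2 = (1 - w) / 2 := by linarith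
  rw [← hu, ← hw] at h
  rw [ha, hs, hb, ht]
  -- The system has determinant `(u - w) / 2`. If it vanishes, all four squares are `1/2` and any `x
  -- + y = 2` works; otherwise Cramer's rule applies, with denominators squared to expose the signs.
  by_cases huw : u - w = 0
  · have hu0 : u = 0 := by nlinarith
    have hw0 : w = 0 := by linarith
    exact ⟨2, 0, by norm_num, le_rfl, by rw [hw0]; norm_num, by rw [hw0]; norm_num⟩
  · have hsq : 0 < (u - w) ^ 2 := by positivity
    refine ⟨2 * (u * (u - w)) / (u - w) ^ 2, 2 * (w * (w - u)) / (u - w) ^ 2, ?_, ?_, ?_, ?_⟩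
    · exact div_nonneg (by nlinarith) hsq.le
    · exact div_nonneg (by nlinarith) hsq.le
    · field_simp
      ring
    · field_simp
      ring

theorem isAntidegradable_krausMap_krausPair {a b s t : ℝ} (h₀ : a ^ 2 + s ^ 2 = 1)
    (h₁ : b ^ 2 + t ^ 2 = 1) (h : (a ^ 2 - s ^ 2) * (b ^ 2 - t ^ 2) ≤ 0) :
    IsAntidegradable (krausMap (krausPair a b s t)) := by
  obtain ⟨x, y, hx, hy, h₂, h₃⟩ := exists_weights h₀ h₁ h
  refine ⟨2, _, _, isComplementary_krausMap_krausPair h₀ h₁,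
    isChannel_krausMap_krausPair ?_ ?_, krausMap_krausPair_comp hx hy h₂ h₃⟩
  · rw [mul_pow, mul_pow, Real.sq_sqrt hx, Real.sq_sqrt hy]
    linarith
  · rw [mul_pow, mul_pow, Real.sq_sqrt hx, Real.sq_sqrt hy]
    linarith

/-! ### Necessity of the sign condition. -/

theorem mul_nonpos_of_probabilities {a b s t p q : ℝ} (h₀ : a ^ 2 + s ^ 2 = 1)
    (h₁ : b ^ 2 + t ^ 2 = 1) (hp0 : 0 ≤ p) (hp1 : p ≤ 1) (hq0 : 0 ≤ q) (hq1 : q ≤ 1)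
    (e₀ : a ^ 2 * p + s ^ 2 * q = a ^ 2) (e₁ : b ^ 2 * p + t ^ 2 * q = t ^ 2) :
    (a ^ 2 - s ^ 2) * (b ^ 2 - t ^ 2) ≤ 0 := by
  have hs : s ^ 2 = 1 - a ^ 2 := by linarith
  have ht : t ^ 2 = 1 - b ^ 2 := by linarith
  rw [hs] at e₀ ⊢
  rw [ht] at e₁ ⊢
  have hu : (a ^ 2 - b ^ 2) * (1 + p - q) = a ^ 2 - (1 - a ^ 2) := by
    linear_combination e₀ - e₁
  have hw : (a ^ 2 - b ^ 2) * (1 + q - p) = -(b ^ 2 - (1 - b ^ 2)) := by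
    linear_combination e₁ - e₀
  -- Both factors are nonnegative because `|p - q| ≤ 1`.
  have h : 0 ≤ (a ^ 2 - b ^ 2) ^ 2 * ((1 + p - q) * (1 + q - p)) :=
    mul_nonneg (sq_nonneg _) (mul_nonneg (by linarith) (by linarith))
  have : (a ^ 2 - b ^ 2) ^ 2 * ((1 + p - q) * (1 + q - p)) =
      -((a ^ 2 - (1 - a ^ 2)) * (b ^ 2 - (1 - b ^ 2))) := by
    rw [← mul_neg, ← hw, ← hu]
    ring
  linarith

theorem mul_nonpos_of_isAntidegradable {a b s t : ℝ} (h₀ : a ^ 2 + s ^ 2 = 1)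
    (h₁ : b ^ 2 + t ^ 2 = 1) (hab : a ≠ 0 ∨ b ≠ 0) (hst : s ≠ 0 ∨ t ≠ 0)
    (h : IsAntidegradable (krausMap (krausPair a b s t))) :
    (a ^ 2 - s ^ 2) * (b ^ 2 - t ^ 2) ≤ 0 := by
  obtain ⟨d, Ψc, Ξ, ⟨-, -, V, -, hV, hVc⟩, hΞ, hcomp⟩ := h
  -- For an arbitrary dilation `V`, the channel records the inner products of the environment
  -- vectors.
  have key : ∀ i j x y, krausMap (krausPair a b s t) (Matrix.single i j 1) x y =
      ∑ e, V (x, e) i * star (V (y, e) j) := fun i j x y => by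
    rw [hV, traceSnd_eq_krausMap, krausMap_single_apply]
    rfl
  obtain ⟨f, hf, hf0, hf1⟩ := exists_unit_of_gram (k := Fin d) hab
    (x := fun e => V (0, e) 0) (y := fun e => V (1, e) 1)
    (by rw [← key, krausMap_krausPair]; simp) (by rw [← key, krausMap_krausPair]; simp)
    (by rw [← key, krausMap_krausPair]; simp)
  obtain ⟨g, hg, hg0, hg1⟩ := exists_unit_of_gram (k := Fin d) hst
    (x := fun e => V (1, e) 0) (y := fun e => V (0, e) 1)
    (by rw [← key, krausMap_krausPair]; simp) (by rw [← key, krausMap_krausPair]; simp)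
    (by rw [← key, krausMap_krausPair]; simp)
  obtain ⟨p, hp0, hp1, hp⟩ := hΞ.exists_prob hf
  obtain ⟨q, hq0, hq1, hq⟩ := hΞ.exists_prob hg
  have hc0 : Ψc (Matrix.single 0 0 1) =
      (a : ℂ) ^ 2 • vecMulVec f (star f) + (s : ℂ) ^ 2 • vecMulVec g (star g) := by
    ext x y
    rw [hVc, traceFst_eq_krausMap, krausMap_single_apply, Fin.sum_univ_two]
    have hf0 := congrFun hf0
    have hg0 := congrFun hg0
    simp only [Pi.smul_apply, smul_eq_mul] at hf0 hg0
    simp [hf0, hg0, vecMulVec_apply, Complex.conj_ofReal]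
    ring
  have hc1 : Ψc (Matrix.single 1 1 1) =
      (b : ℂ) ^ 2 • vecMulVec f (star f) + (t : ℂ) ^ 2 • vecMulVec g (star g) := by
    ext x y
    rw [hVc, traceFst_eq_krausMap, krausMap_single_apply, Fin.sum_univ_two]
    have hf1 := congrFun hf1
    have hg1 := congrFun hg1
    simp only [Pi.smul_apply, smul_eq_mul] at hf1 hg1
    simp [hf1, hg1, vecMulVec_apply, Complex.conj_ofReal]
    ring
  have e₀ : (a : ℂ) ^ 2 * p + (s : ℂ) ^ 2 * q = (a : ℂ) ^ 2 := by
    have := congrFun₂ (LinearMap.congr_fun hcomp (Matrix.single 0 0 1)) 0 0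
    rw [krausMap_krausPair, LinearMap.comp_apply, hc0, map_add, map_smul, map_smul] at this
    simpa [hp, hq] using this.symm
  have e₁ : (b : ℂ) ^ 2 * p + (t : ℂ) ^ 2 * q = (t : ℂ) ^ 2 := by
    have := congrFun₂ (LinearMap.congr_fun hcomp (Matrix.single 1 1 1)) 0 0
    rw [krausMap_krausPair, LinearMap.comp_apply, hc1, map_add, map_smul, map_smul] at this
    simpa [hp, hq] using this.symm
  exact mul_nonpos_of_probabilities h₀ h₁ hp0 hp1 hq0 hq1 (by exact_mod_cast e₀)
    (by exact_mod_cast e₁)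

end QChannel

theorem mainTheorem2 (α β : ℝ)
    (Φ : Matrix (Fin 2) (Fin 2) ℂ →ₗ[ℂ] Matrix (Fin 2) (Fin 2) ℂ)
    (hΦ : Φ = QChannel.krausMap ![QChannel.kraus₁ α β, QChannel.kraus₂ α β])
    (hrank : (QChannel.choiMatrix Φ).rank = 2) :
    QChannel.IsAntidegradable Φ ↔ Real.cos (2 * α) * Real.cos (2 * β) ≤ 0 := by
  subst hΦ
  -- Each Kraus operator adds at most one to the Choi rank, so neither vanishes; this provides the
  -- unit vectors `f` and `g`.
  have hK : ¬ (QChannel.kraus₁ α β = 0 ∨ QChannel.kraus₂ α β = 0) := fun h => by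
    have := QChannel.rank_choiMatrix_krausMap_pair_le h
    omega
  rw [not_or] at hK
  have hab : Real.cos α ≠ 0 ∨ Real.cos β ≠ 0 := by
    by_contra! h
    apply hK.1
    ext i j
    fin_cases i <;> fin_cases j <;>
      simp [QChannel.kraus₁, h.1, h.2, -Complex.ofReal_cos]
  have hst : Real.sin α ≠ 0 ∨ Real.sin β ≠ 0 := by
    by_contra! h
    apply hK.2
    ext i j
    fin_cases i <;> fin_cases j <;>
      simp [QChannel.kraus₂, h.1, h.2, -Complex.ofReal_sin]
  rw [Real.cos_two_mul', Real.cos_two_mul', ← QChannel.krausPair_cos_sin]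
  exact ⟨QChannel.mul_nonpos_of_isAntidegradable (Real.cos_sq_add_sin_sq α)
      (Real.cos_sq_add_sin_sq β) hab hst,
    QChannel.isAntidegradable_krausMap_krausPair (Real.cos_sq_add_sin_sq α)
      (Real.cos_sq_add_sin_sq β)⟩
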